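/- Let $(R,\mathfrak m)$ be a Noetherian local ring of prime characteristic $p>0$. For an ideal $I\subseteq R$ and $q=p^e$ let $I^{[q]}=(y^q \mid y\in I)$, and let $I^*$ be the tight closure of $I$: the ideal of all $x\in R$ for which there is an element $c$, contained in no minimal prime of $R$, such that $cx^q\in I^{[q]}$ for all $q=p^e\gg 0$. A parameter of a local ring $(A,\mathfrak n)$ is an element $x\in\mathfrak n$ with $\dim A/(x)=\dim A-1$; a parameter ideal of $R$ is an ideal $(x_1,\ldots,x_t)$, $t\ge 0$, such that $x_{i+1}$ is a parameter in $R/(x_1,\ldots,x_i)$ for all $0\le i<t$ (for $t=0$ this is the ideal $(0)$). Assume that $R$ is F-rational, i.e. $J^*=J$ for every parameter ideal $J$ of $R$. Then the following are equivalent: 1. $R$ is weakly F-regular, i.e. $I^*=I$ for every ideal $I\subseteq R$; 2. $(IJ)^*=I^*J^*$ for all ideals $I,J\subseteq R$; 3. $(IJ)^*=I^*J$ for all ideals $I\subseteq R$ and all parameter ideals $J\subseteq R$. -/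

import Mathlib

namespace TightClosure

/-- The Frobenius power `I^{[p ^ e]}`: the ideal generated by the `p ^ e`-th powers of all
elements of `I`. -/
def frobeniusPower {R : Type*} [CommRing R] (p e : ℕ) (I : Ideal R) : Ideal R :=
  Ideal.span ((fun y : R => y ^ p ^ e) '' (I : Set R))

/-- `R°`, the complement of the union of the minimal primes of `R`, as a submonoid of `R`. -/
def complMinimalPrimes (R : Type*) [CommRing R] : Submonoid R where
  carrier := {c | ∀ P ∈ minimalPrimes R, c ∉ P}
  one_mem' := fun _ hP => hP.1.1.one_notMem
  mul_mem' := fun ha hb P hP hab => (hP.1.1.mem_or_mem hab).elim (ha P hP) (hb P hP)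

/-- The tight closure `I^*` of an ideal `I` of a ring of prime characteristic `p`: all `x` for
which there is a `c ∈ R°` with `c * x ^ q ∈ I^{[q]}` for all large powers `q = p ^ e`. -/
def tightClosure {R : Type*} [CommRing R] (p : ℕ) [Fact p.Prime] [CharP R p] (I : Ideal R) :
    Ideal R where
  carrier := {x | ∃ c ∈ complMinimalPrimes R,
    ∃ e₀ : ℕ, ∀ e ≥ e₀, c * x ^ p ^ e ∈ frobeniusPower p e I}
  zero_mem' := ⟨1, one_mem _, 0, fun e _ => by
    rw [zero_pow (pow_ne_zero _ (Fact.out : p.Prime).ne_zero), mul_zero]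
    exact Ideal.zero_mem _⟩
  add_mem' := by
    rintro x y ⟨c, hc, m, hm⟩ ⟨d, hd, n, hn⟩
    refine ⟨c * d, mul_mem hc hd, max m n, fun e he => ?_⟩
    have h : c * d * (x + y) ^ p ^ e = d * (c * x ^ p ^ e) + c * (d * y ^ p ^ e) := by
      rw [add_pow_char_pow]; ring
    rw [h]
    exact Ideal.add_mem _ (Ideal.mul_mem_left _ _ (hm e (le_of_max_le_left he)))
      (Ideal.mul_mem_left _ _ (hn e (le_of_max_le_right he)))
  smul_mem' := by
    rintro r x ⟨c, hc, m, hm⟩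
    refine ⟨c, hc, m, fun e he => ?_⟩
    have h : c * (r • x) ^ p ^ e = r ^ p ^ e * (c * x ^ p ^ e) := by
      rw [smul_eq_mul, mul_pow]; ring
    rw [h]
    exact Ideal.mul_mem_left _ _ (hm e he)

/-- A parameter of a local ring `A`: an element `x` of the maximal ideal (that is, a nonunit) such
that `dim (A / (x)) = dim A - 1`. -/
def IsParameter {A : Type*} [CommRing A] (x : A) : Prop :=
  x ∈ nonunits A ∧ ringKrullDim (A ⧸ Ideal.span {x}) + 1 = ringKrullDim A

/-- A (possibly partial, possibly empty) system of parameters: each `x i` is a parameter in the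
quotient of `R` by the ideal generated by the preceding elements. -/
def IsSystemOfParameters {R : Type*} [CommRing R] {t : ℕ} (x : Fin t → R) : Prop :=
  ∀ i : Fin t, IsParameter (Ideal.Quotient.mk (Ideal.span (x '' {j | j < i})) (x i))

/-- A parameter ideal: an ideal generated by a (possibly partial, possibly empty) system of
parameters. -/
def IsParameterIdeal {R : Type*} [CommRing R] (q : Ideal R) : Prop :=
  ∃ (t : ℕ) (x : Fin t → R), IsSystemOfParameters x ∧ q = Ideal.span (Set.range x)

/-- F-rationality (of a local ring of characteristic `p`): every parameter ideal is tightly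
closed. -/
def IsFRational (R : Type*) [CommRing R] (p : ℕ) [Fact p.Prime] [CharP R p] : Prop :=
  ∀ q : Ideal R, IsParameterIdeal q → tightClosure p q = q

/-- Weak F-regularity: every ideal is tightly closed. -/
def IsWeaklyFRegular (R : Type*) [CommRing R] (p : ℕ) [Fact p.Prime] [CharP R p] : Prop :=
  ∀ I : Ideal R, tightClosure p I = I

end TightClosure

namespace TightClosure

open IsLocalRing

/-! ### Formal properties of Frobenius powers and tight closure. -/

section Basic

variable {R : Type*} [CommRing R]

/-! Only 3 → 1 has content. By Krull's intersection theorem it suffices to treat ideals `L`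
containing a power of the maximal ideal `m`. F-rationality makes `R` reduced, so either `R` is a
field or `m` contains a nonzerodivisor.

If `m = (t)`, then `L = (t ^ k)` is a parameter ideal. Otherwise choose a nonzerodivisor `x ∈ L`:
`m` is not associated to `R ⧸ (x)`, since a socle element outside `(x)` would either lie in `(x)^* =
(x)` or make `m` principal (`exists_maximalIdeal_eq_span_singleton`). Hence `L` contains elements
`f` regular modulo `x`.

The key step is `tightClosure_sup_span_singleton`: if `I` is tightly closed and contains `x`, then
`x (I + (f)) ⊆ I (x, f)`, so condition 3 for the parameter ideal `(x, f)` shows that `I + (f)` is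
tightly closed. Starting from `(x)`, Noetherian induction and prime avoidance reach `L`. -/

theorem pow_mem_frobeniusPower (p e : ℕ) {I : Ideal R} {x : R} (hx : x ∈ I) :
    x ^ p ^ e ∈ frobeniusPower p e I :=
  Ideal.subset_span ⟨x, hx, rfl⟩

theorem frobeniusPower_mono (p e : ℕ) {I J : Ideal R} (h : I ≤ J) :
    frobeniusPower p e I ≤ frobeniusPower p e J :=
  Ideal.span_mono (Set.image_mono h)

theorem pow_mul_mem_frobeniusPower (p e : ℕ) {I J : Ideal R} {x w : R}
    (h : ∀ y ∈ I, x * y ∈ J) (hw : w ∈ frobeniusPower p e I) :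
    x ^ p ^ e * w ∈ frobeniusPower p e J := by
  have hle : frobeniusPower p e I ≤
      Submodule.comap (LinearMap.mulLeft R (x ^ p ^ e)) (frobeniusPower p e J) := by
    refine Ideal.span_le.mpr ?_
    rintro _ ⟨y, hy, rfl⟩
    simpa [mul_pow] using pow_mem_frobeniusPower p e (h y hy)
  simpa using hle hw

theorem mem_complMinimalPrimes_of_mem_nonZeroDivisors {x : R} (hx : x ∈ nonZeroDivisors R) :
    x ∈ complMinimalPrimes R := fun _ hP hxP =>
  Set.disjoint_left.mp (Ideal.disjoint_nonZeroDivisors_of_mem_minimalPrimes hP) hxP hx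

theorem isParameterIdeal_bot : IsParameterIdeal (⊥ : Ideal R) :=
  ⟨0, Fin.elim0, fun i => i.elim0, by simp⟩

/-- The zero ideal is a parameter ideal, and its tight closure contains every nilpotent. -/
theorem IsFRational.isReduced {p : ℕ} [Fact p.Prime] [CharP R p]
    (hR : IsFRational R p) : IsReduced R := by
  refine ⟨fun x ⟨n, hn⟩ => ?_⟩
  have hx : x ∈ tightClosure p (⊥ : Ideal R) := by
    refine ⟨1, one_mem _, n, fun e he => ?_⟩
    have : n ≤ p ^ e := he.trans (Nat.lt_pow_self (Fact.out : p.Prime).one_lt).le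
    rw [pow_eq_zero_of_le this hn, mul_zero]
    exact zero_mem _
  rwa [hR ⊥ isParameterIdeal_bot] at hx

variable (p : ℕ) [Fact p.Prime] [CharP R p]

theorem le_tightClosure (I : Ideal R) : I ≤ tightClosure p I := fun _ hx =>
  ⟨1, one_mem _, 0, fun e _ => Ideal.mul_mem_left _ _ (pow_mem_frobeniusPower p e hx)⟩

theorem tightClosure_mono {I J : Ideal R} (h : I ≤ J) : tightClosure p I ≤ tightClosure p J := by
  rintro x ⟨c, hc, e₀, H⟩
  exact ⟨c, hc, e₀, fun e he => frobeniusPower_mono p e h (H e he)⟩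

theorem tightClosure_top : tightClosure p (⊤ : Ideal R) = ⊤ :=
  top_le_iff.mp (le_tightClosure p ⊤)

theorem mul_mem_tightClosure {I J : Ideal R} {x z : R} (h : ∀ y ∈ I, x * y ∈ J)
    (hz : z ∈ tightClosure p I) : x * z ∈ tightClosure p J := by
  obtain ⟨c, hc, e₀, H⟩ := hz
  refine ⟨c, hc, e₀, fun e he => ?_⟩
  rw [mul_pow, mul_left_comm]
  exact pow_mul_mem_frobeniusPower p e h (H e he)

end Basic

/-! ### Parameter ideals from regular sequences of length one and two. -/

section Parameters

variable {R : Type*} [CommRing R] [IsNoetherianRing R] [IsLocalRing R]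

/-- A sequence in the maximal ideal, each of whose members is a nonzerodivisor modulo the
preceding ones, is a system of parameters. -/
theorem isSystemOfParameters_of_regular {t : ℕ} {x : Fin t → R}
    (hm : ∀ i, x i ∈ maximalIdeal R)
    (hreg : ∀ i, ∀ r, x i * r ∈ Ideal.span (x '' {j | j < i}) →
      r ∈ Ideal.span (x '' {j | j < i})) : IsSystemOfParameters x := by
  intro i
  set I := Ideal.span (x '' {j | j < i}) with hI
  have hIm : I ≤ maximalIdeal R := by
    refine Ideal.span_le.mpr ?_
    rintro _ ⟨j, -, rfl⟩
    exact hm j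
  have : Nontrivial (R ⧸ I) :=
    Ideal.Quotient.nontrivial_iff.mpr fun h =>
      (maximalIdeal.isMaximal R).ne_top (top_le_iff.mp (h ▸ hIm))
  have : IsLocalRing (R ⧸ I) :=
    IsLocalRing.of_surjective' (Ideal.Quotient.mk I) Ideal.Quotient.mk_surjective
  have hnu : Ideal.Quotient.mk I (x i) ∈ nonunits (R ⧸ I) := by
    intro hu
    obtain ⟨y, hy⟩ := hu.exists_right_inv
    obtain ⟨y, rfl⟩ := Ideal.Quotient.mk_surjective y
    rw [← map_mul, ← map_one (Ideal.Quotient.mk I), Ideal.Quotient.eq] at hy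
    have h1 : (1 : R) ∈ maximalIdeal R := by
      rw [← sub_sub_cancel (x i * y) 1]
      exact sub_mem (Ideal.mul_mem_right y _ (hm i)) (hIm hy)
    exact (maximalIdeal.isMaximal R).ne_top ((Ideal.eq_top_iff_one _).mpr h1)
  refine ⟨hnu, ringKrullDim_quotient_span_singleton_succ_eq_ringKrullDim_of_mem_nonZeroDivisors
    (mem_nonZeroDivisors_iff_right.mpr fun r hr => ?_) hnu⟩
  obtain ⟨r, rfl⟩ := Ideal.Quotient.mk_surjective r
  rw [← map_mul, Ideal.Quotient.eq_zero_iff_mem, mul_comm] at hr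
  exact Ideal.Quotient.eq_zero_iff_mem.mpr (hreg i r hr)

theorem isParameterIdeal_span_singleton {x : R} (hx : x ∈ nonZeroDivisors R)
    (hxm : x ∈ maximalIdeal R) : IsParameterIdeal (Ideal.span {x}) := by
  refine ⟨1, ![x], isSystemOfParameters_of_regular (by simpa using hxm) fun i r hr => ?_, by simp⟩
  fin_cases i
  simp only [Fin.zero_eta, Fin.not_lt_zero, Set.ofPred_false, Set.image_empty, Ideal.span_empty,
    Matrix.cons_val_zero, Ideal.mem_bot] at hr ⊢
  exact (mul_right_mem_nonZeroDivisors_eq_zero_iff hx).mp (by rwa [mul_comm])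

theorem isParameterIdeal_span_pair {x f : R} (hx : x ∈ nonZeroDivisors R)
    (hxm : x ∈ maximalIdeal R) (hfm : f ∈ maximalIdeal R)
    (hf : ∀ r, f * r ∈ Ideal.span {x} → r ∈ Ideal.span {x}) :
    IsParameterIdeal (Ideal.span {x, f}) := by
  refine ⟨2, ![x, f], isSystemOfParameters_of_regular ?_ ?_, by simp [Set.pair_comm]⟩
  · intro i
    fin_cases i
    · exact hxm
    · exact hfm
  · intro i r hr
    fin_cases i
    · simp only [Fin.zero_eta, Fin.not_lt_zero, Set.ofPred_false, Set.image_empty,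
        Ideal.span_empty, Matrix.cons_val_zero, Ideal.mem_bot] at hr ⊢
      exact (mul_right_mem_nonZeroDivisors_eq_zero_iff hx).mp (by rwa [mul_comm])
    · have : ![x, f] '' {j | j < (1 : Fin 2)} = {x} := by
        ext y
        simp [eq_comm]
      simp only [Fin.mk_one, this] at hr ⊢
      exact hf r hr

end Parameters

/-! ### Socle elements and principal maximal ideals. -/

section PrincipalMaximalIdeal

variable {R : Type*} [CommRing R] [IsLocalRing R]

/-- If the maximal ideal is associated to a tightly closed principal ideal generated by a
nonzerodivisor, then it is principal. -/
theorem exists_maximalIdeal_eq_span_singleton {p : ℕ} [Fact p.Prime] [CharP R p]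
    {x u : R} (hx : x ∈ nonZeroDivisors R)
    (hxm : x ∈ maximalIdeal R) (hc : tightClosure p (Ideal.span {x}) = Ideal.span {x})
    (hu : u ∉ Ideal.span {x}) (hmu : ∀ s ∈ maximalIdeal R, s * u ∈ Ideal.span {x}) :
    ∃ t, maximalIdeal R = Ideal.span {t} := by
  -- Either `m u ⊆ x m`, and iterating gives `m u ^ n ⊆ (x ^ n)`, or some `s * u` is `x` times a
  -- unit, and then `s` generates `m`.
  by_cases H : ∀ s ∈ maximalIdeal R, ∃ r ∈ maximalIdeal R, s * u = x * r
  · have hpow : ∀ n : ℕ, ∀ s ∈ maximalIdeal R, ∃ r, s * u ^ n = x ^ n * r := by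
      intro n
      induction n with
      | zero => exact fun s _ => ⟨s, by simp⟩
      | succ n ih =>
        intro s hs
        obtain ⟨r, hr, hsr⟩ := H s hs
        obtain ⟨r', hr'⟩ := ih r hr
        refine ⟨r', ?_⟩
        calc s * u ^ (n + 1) = (s * u) * u ^ n := by ring
          _ = x * (r * u ^ n) := by rw [hsr]; ring
          _ = x ^ (n + 1) * r' := by rw [hr']; ring
    refine absurd ?_ hu
    rw [← hc]
    -- The multiplier is `x` itself: it lies in `m` and, as a nonzerodivisor, avoids every minimal
    -- prime.
    refine ⟨x, mem_complMinimalPrimes_of_mem_nonZeroDivisors hx, 0, fun e _ => ?_⟩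
    obtain ⟨r, hr⟩ := hpow (p ^ e) x hxm
    rw [hr]
    exact Ideal.mul_mem_right _ _
      (pow_mem_frobeniusPower p e (Ideal.mem_span_singleton_self x))
  · push Not at H
    obtain ⟨s, hs, H⟩ := H
    obtain ⟨r, hr⟩ := Ideal.mem_span_singleton.mp (hmu s hs)
    have hrm : r ∉ maximalIdeal R := fun h => H r h hr
    obtain ⟨v, hv⟩ := (not_not.mp fun h => hrm h : IsUnit r).exists_right_inv
    refine ⟨s, le_antisymm (fun a ha => ?_) ((Ideal.span_singleton_le_iff_mem _).mpr hs)⟩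
    obtain ⟨b, hb⟩ := Ideal.mem_span_singleton.mp (hmu a ha)
    refine Ideal.mem_span_singleton.mpr ⟨v * b, ?_⟩
    have hxe : x = s * u * v := by rw [hr, mul_assoc, hv, mul_one]
    have h0 : (a - s * (v * b)) * x = 0 := by
      calc (a - s * (v * b)) * x = a * x - s * (v * b) * x := by ring
        _ = (a * u) * s * v - s * (v * b) * x := by nth_rewrite 1 [hxe]; ring
        _ = 0 := by rw [hb]; ring
    exact sub_eq_zero.mp ((mul_right_mem_nonZeroDivisors_eq_zero_iff hx).mp h0)

/-- An ideal of a local ring with principal maximal ideal `(t)` is a power of `(t)` as soon as it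
contains one. -/
theorem exists_eq_span_pow {t : R} (ht : maximalIdeal R = Ideal.span {t}) {L : Ideal R} {n : ℕ}
    (hn : t ^ n ∈ L) : ∃ k, L = Ideal.span {t ^ k} := by
  classical
  have hex : ∃ k, t ^ k ∈ L := ⟨n, hn⟩
  refine ⟨Nat.find hex, le_antisymm (fun a ha => ?_)
    ((Ideal.span_singleton_le_iff_mem _).mpr (Nat.find_spec hex))⟩
  have key : ∀ j ≤ Nat.find hex, t ^ j ∣ a := by
    intro j
    induction j with
    | zero => simp
    | succ j ih =>
      intro hj
      obtain ⟨u, hu⟩ := ih (by omega)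
      have hum : u ∈ maximalIdeal R := by
        by_contra h
        have hunit : IsUnit u := not_not.mp fun h' => h h'
        obtain ⟨v, hv⟩ := hunit.exists_right_inv
        refine Nat.find_min hex (m := j) (by omega) ?_
        have : t ^ j = a * v := by rw [hu, mul_assoc, hv, mul_one]
        rw [this]
        exact L.mul_mem_right _ ha
      rw [ht, Ideal.mem_span_singleton] at hum
      rw [hu, pow_succ]
      exact mul_dvd_mul_left _ hum
  exact Ideal.mem_span_singleton.mpr (key _ le_rfl)

end PrincipalMaximalIdeal

/-! ### Tight closedness of all ideals from the product formula. -/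

section Local

variable {R : Type*} [CommRing R] [IsNoetherianRing R] [IsLocalRing R]
  {p : ℕ} [Fact p.Prime] [CharP R p]

/-- If the maximal ideal has no nonzerodivisors, a reduced Noetherian local ring is a field. -/
theorem maximalIdeal_eq_bot_of_forall_notMem [IsReduced R]
    (h : ∀ x ∈ maximalIdeal R, x ∉ nonZeroDivisors R) : maximalIdeal R = ⊥ := by
  have hsub : (maximalIdeal R : Set R) ⊆ ⋃ P ∈ associatedPrimes R R, (P : Set R) := by
    rw [biUnion_associatedPrimes_eq_compl_nonZeroDivisors]
    exact h
  -- Prime avoidance yields `u` with `m u = 0`; if `u ∈ m` then `u ^ 2 = 0`, against reducedness, so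
  -- `u` is a unit.
  obtain ⟨P, hP, hle⟩ := (Ideal.subset_union_prime_finite (associatedPrimes.finite R R)
    (f := id) ⊥ ⊥ fun _ h _ _ => h.isPrime).mp hsub
  obtain ⟨hPp, u, hu⟩ := isAssociatedPrime_iff.mp (AssociatedPrimes.mem_iff.mp hP)
  have hann : ∀ s ∈ maximalIdeal R, s * u = 0 := fun s hs => by
    have : s ∈ P := hle hs
    rw [hu] at this
    simpa [Submodule.mem_colon_singleton] using this
  by_cases hum : u ∈ maximalIdeal R
  · have hu0 : u = 0 := IsReduced.eq_zero u ⟨2, by rw [sq, hann u hum]⟩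
    refine absurd ?_ hPp.ne_top
    rw [hu, Ideal.eq_top_iff_one]
    simp [hu0, Submodule.mem_colon_singleton]
  · have hunit : IsUnit u := not_not.mp fun h => hum h
    exact (Submodule.eq_bot_iff _).mpr fun s hs => hunit.mul_left_eq_zero.mp (hann s hs)

/-- Adjoining to a tightly closed ideal containing a nonzerodivisor `x` an element regular modulo
`x` gives a tightly closed ideal, if products with parameter ideals commute with tight closure. -/
theorem tightClosure_sup_span_singleton
    (h : ∀ I J : Ideal R, IsParameterIdeal J →
      tightClosure p (I * J) = tightClosure p I * J)
    {I : Ideal R} (hI : tightClosure p I = I) {x f : R} (hx : x ∈ nonZeroDivisors R)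
    (hxm : x ∈ maximalIdeal R) (hxI : x ∈ I) (hfm : f ∈ maximalIdeal R)
    (hf : ∀ r, f * r ∈ Ideal.span {x} → r ∈ Ideal.span {x}) :
    tightClosure p (I ⊔ Ideal.span {f}) = I ⊔ Ideal.span {f} := by
  refine le_antisymm (fun z hz => ?_) (le_tightClosure p _)
  have hmul : ∀ y ∈ I ⊔ Ideal.span {f}, x * y ∈ I * Ideal.span {x, f} := by
    intro y hy
    obtain ⟨a, ha, b, hb, rfl⟩ := Submodule.mem_sup.mp hy
    obtain ⟨c, rfl⟩ := Ideal.mem_span_singleton.mp hb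
    have hxJ : x ∈ Ideal.span {x, f} := Ideal.subset_span (by simp)
    have hfJ : f ∈ Ideal.span {x, f} := Ideal.subset_span (by simp)
    rw [mul_add]
    refine add_mem ?_ ?_
    · rw [mul_comm x a]
      exact Ideal.mul_mem_mul ha hxJ
    · exact Ideal.mul_mem_mul hxI (Ideal.mul_mem_right _ _ hfJ)
  have hxz := mul_mem_tightClosure p hmul hz
  rw [h I _ (isParameterIdeal_span_pair hx hxm hfm hf), hI, Ideal.span_insert, Ideal.mul_sup,
    Submodule.mem_sup] at hxz
  obtain ⟨a, ha, b, hb, hab⟩ := hxz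
  obtain ⟨a, haI, rfl⟩ := Ideal.mem_mul_span_singleton.mp ha
  obtain ⟨b, hbI, rfl⟩ := Ideal.mem_mul_span_singleton.mp hb
  -- From `x z = a x + b f`, regularity of `f` modulo `x` forces `x ∣ b`; then `x` can be cancelled.
  have hbx : b ∈ Ideal.span {x} := hf b <| Ideal.mem_span_singleton.mpr
    ⟨z - a, by linear_combination hab⟩
  obtain ⟨c, rfl⟩ := Ideal.mem_span_singleton.mp hbx
  have h0 : (z - (a + f * c)) * x = 0 := by linear_combination -hab
  rw [sub_eq_zero.mp ((mul_right_mem_nonZeroDivisors_eq_zero_iff hx).mp h0)]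
  exact add_mem (Ideal.mem_sup_left haI)
    (Ideal.mem_sup_right (Ideal.mul_mem_right _ _ (Ideal.mem_span_singleton_self f)))

/-- Ideals containing a nonzerodivisor `x` and lying in no associated prime of `R ⧸ (x)` are
tightly closed. -/
theorem tightClosure_eq_of_forall_not_le (hR : IsFRational R p)
    (h : ∀ I J : Ideal R, IsParameterIdeal J →
      tightClosure p (I * J) = tightClosure p I * J)
    {L : Ideal R} (hLm : L ≤ maximalIdeal R) {x : R} (hx : x ∈ nonZeroDivisors R) (hxL : x ∈ L)
    (hL : ∀ P ∈ associatedPrimes R (R ⧸ Ideal.span {x}), ¬ L ≤ P) :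
    tightClosure p L = L := by
  obtain ⟨I, ⟨hIc, hxI, hIL⟩, hmax⟩ := set_has_maximal_iff_noetherian.mpr ‹IsNoetherianRing R›
    {I : Ideal R | tightClosure p I = I ∧ x ∈ I ∧ I ≤ L}
    ⟨Ideal.span {x}, hR _ (isParameterIdeal_span_singleton hx (hLm hxL)),
      Ideal.mem_span_singleton_self x, (Ideal.span_singleton_le_iff_mem _).mpr hxL⟩
  suffices I = L from this ▸ hIc
  by_contra hne
  have hLI : ¬ L ≤ I := fun hle => hne (le_antisymm hIL hle)
  obtain ⟨f, hfL, hfI, hfP⟩ : ∃ f ∈ L, f ∉ I ∧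
      ∀ P ∈ associatedPrimes R (R ⧸ Ideal.span {x}), f ∉ P := by
    by_contra! hcon
    have hsub : (L : Set R) ⊆
        ⋃ P ∈ insert I (associatedPrimes R (R ⧸ Ideal.span {x})), (P : Set R) := by
      intro f hf
      by_cases hfI : f ∈ I
      · exact Set.mem_biUnion (Set.mem_insert _ _) hfI
      · obtain ⟨P, hP, hfP⟩ := hcon f hf hfI
        exact Set.mem_biUnion (Set.mem_insert_of_mem _ hP) hfP
    -- Prime avoidance tolerates `I`, the only member of the family that need not be prime.
    obtain ⟨P, hP, hle⟩ := (Ideal.subset_union_prime_finite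
      ((associatedPrimes.finite R (R ⧸ Ideal.span {x})).insert I) (f := id) I I
      fun P hP hPI _ => ((Set.mem_insert_iff.mp hP).resolve_left hPI).isPrime).mp hsub
    rcases Set.mem_insert_iff.mp hP with rfl | hP
    · exact hLI hle
    · exact hL P hP hle
  have hreg : ∀ r, f * r ∈ Ideal.span {x} → r ∈ Ideal.span {x} := by
    intro r hr
    by_contra hrx
    have hmem : f ∈ ⋃ P ∈ associatedPrimes R (R ⧸ Ideal.span {x}), (P : Set R) := by
      rw [biUnion_associatedPrimes_eq_zero_divisors]
      refine ⟨Ideal.Quotient.mk _ r, fun h0 => hrx (Ideal.Quotient.eq_zero_iff_mem.mp h0), ?_⟩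
      exact Ideal.Quotient.eq_zero_iff_mem.mpr hr
    obtain ⟨P, hP, hfP'⟩ := Set.mem_iUnion₂.mp hmem
    exact hfP P hP hfP'
  refine hmax (I ⊔ Ideal.span {f})
    ⟨tightClosure_sup_span_singleton h hIc hx (hLm hxL) hxI (hLm hfL) hreg,
      Ideal.mem_sup_left hxI,
      sup_le hIL ((Ideal.span_singleton_le_iff_mem _).mpr hfL)⟩
    (lt_of_le_of_ne le_sup_left fun heq => hfI ?_)
  rw [heq]
  exact Ideal.mem_sup_right (Ideal.mem_span_singleton_self f)

/-- Tight closure is monotone, so `L^*` lies in every `L + m ^ n`; their intersection is `L` by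
Krull's theorem in `R ⧸ L`. -/
theorem isWeaklyFRegular_of_sup_pow
    (h : ∀ (L : Ideal R) (n : ℕ), maximalIdeal R ^ n ≤ L → tightClosure p L = L) :
    IsWeaklyFRegular R p := by
  intro L
  refine le_antisymm (fun z hz => ?_) (le_tightClosure p L)
  have hmem : ∀ n : ℕ, z ∈ L ⊔ maximalIdeal R ^ n := fun n => by
    rw [← h (L ⊔ maximalIdeal R ^ n) n le_sup_right]
    exact tightClosure_mono p le_sup_left hz
  by_cases hL : L = ⊤
  · simp [hL]
  have hinf : (⨅ n : ℕ, maximalIdeal R ^ n • (⊤ : Submodule R (R ⧸ L))) = ⊥ :=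
    Ideal.iInf_pow_smul_eq_bot_of_isLocalRing _ (maximalIdeal.isMaximal R).ne_top
  have hz0 : Ideal.Quotient.mk L z ∈ (⨅ n : ℕ, maximalIdeal R ^ n • (⊤ : Submodule R (R ⧸ L))) := by
    refine (Submodule.mem_iInf _).mpr fun n => ?_
    obtain ⟨a, ha, b, hb, hab⟩ := Submodule.mem_sup.mp (hmem n)
    have : Ideal.Quotient.mk L z = b • (1 : R ⧸ L) := by
      rw [← hab, map_add, Ideal.Quotient.eq_zero_iff_mem.mpr ha, zero_add, Algebra.smul_def,
        mul_one]
      rfl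
    rw [this]
    exact Submodule.smul_mem_smul hb trivial
  rw [hinf, Submodule.mem_bot] at hz0
  exact Ideal.Quotient.eq_zero_iff_mem.mp hz0

theorem IsFRational.isWeaklyFRegular (hR : IsFRational R p)
    (h : ∀ I J : Ideal R, IsParameterIdeal J →
      tightClosure p (I * J) = tightClosure p I * J) :
    IsWeaklyFRegular R p := by
  have := hR.isReduced
  refine isWeaklyFRegular_of_sup_pow fun L n hn => ?_
  by_cases hLm : L ≤ maximalIdeal R
  swap
  · have hL : L = ⊤ := not_not.mp fun hne => hLm (le_maximalIdeal hne)
    rw [hL, tightClosure_top]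
  by_cases hex : ∃ x ∈ maximalIdeal R, x ∈ nonZeroDivisors R
  swap
  · push Not at hex
    rw [maximalIdeal_eq_bot_of_forall_notMem hex, le_bot_iff] at hLm
    rw [hLm, hR ⊥ isParameterIdeal_bot]
  obtain ⟨x, hxm, hx⟩ := hex
  by_cases hprin : ∃ t, maximalIdeal R = Ideal.span {t}
  · obtain ⟨t, ht⟩ := hprin
    have htm : t ∈ maximalIdeal R := ht ▸ Ideal.mem_span_singleton_self t
    have htr : t ∈ nonZeroDivisors R := by
      obtain ⟨c, rfl⟩ := Ideal.mem_span_singleton.mp (ht ▸ hxm)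
      exact (mul_mem_nonZeroDivisors.mp hx).1
    obtain ⟨k, rfl⟩ := exists_eq_span_pow ht (hn (Ideal.pow_mem_pow htm n))
    exact hR _ (isParameterIdeal_span_singleton (pow_mem htr k)
      (hLm (Ideal.mem_span_singleton_self _)))
  · have hxn : x ^ n ∈ L := hn (Ideal.pow_mem_pow hxm n)
    have hxr : x ^ n ∈ nonZeroDivisors R := pow_mem hx n
    -- An associated prime `P` containing `L` contains `m ^ n`, hence `m`, so its witness `u` is a
    -- socle element modulo `x ^ n`.
    refine tightClosure_eq_of_forall_not_le hR h hLm hxr hxn fun P hP hLP => hprin ?_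
    obtain ⟨hPp, u, hu⟩ := isAssociatedPrime_iff.mp (AssociatedPrimes.mem_iff.mp hP)
    have hmP : maximalIdeal R ≤ P := hPp.le_of_pow_le (hn.trans hLP)
    obtain ⟨u, rfl⟩ := Ideal.Quotient.mk_surjective u
    refine exists_maximalIdeal_eq_span_singleton (p := p) hxr (hLm hxn)
      (hR _ (isParameterIdeal_span_singleton hxr (hLm hxn))) (u := u) (fun hux => ?_) ?_
    · refine hPp.ne_top ?_
      rw [hu, Ideal.eq_top_iff_one, Submodule.mem_colon_singleton, one_smul, Submodule.mem_bot]
      exact Ideal.Quotient.eq_zero_iff_mem.mpr hux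
    · intro s hs
      have := hmP hs
      rw [hu, Submodule.mem_colon_singleton, Submodule.mem_bot] at this
      exact Ideal.Quotient.eq_zero_iff_mem.mp this

end Local

end TightClosure

theorem theorem3p10 {R : Type*} [CommRing R] [IsNoetherianRing R] [IsLocalRing R]
    (p : ℕ) [Fact p.Prime] [CharP R p] (hR : TightClosure.IsFRational R p) :
    List.TFAE [
      TightClosure.IsWeaklyFRegular R p,
      ∀ I J : Ideal R, TightClosure.tightClosure p (I * J) =
        TightClosure.tightClosure p I * TightClosure.tightClosure p J,
      ∀ I J : Ideal R, TightClosure.IsParameterIdeal J →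
        TightClosure.tightClosure p (I * J) = TightClosure.tightClosure p I * J] := by
  tfae_have 1 → 2 := fun h I J => by rw [h, h, h]
  tfae_have 2 → 3 := fun h I J hJ => by rw [h, hR J hJ]
  tfae_have 3 → 1 := hR.isWeaklyFRegular
  tfae_finish
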